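/- Let $\mathcal D$ range over the (Borel) probability distributions of pairs $(f,y)$ on $[0,1]\times\{0,1\}$; $\mathcal D$ is perfectly calibrated if $\mathbb E[y\mid f]=f$ almost surely. For a distance $\rho$ on $[0,1]\times\{0,1\}$ with values in $[0,\infty]$, the Wasserstein distance $W_\rho(\mathcal D,\mathcal D')$ is the infimum of $\mathbb E\,\rho$ over all couplings of $\mathcal D$ and $\mathcal D'$. For a metric $d:[0,1]^2\to[0,\infty]$ (the value $\infty$ is allowed), let $\underline{\mathrm{dCE}}_d(\mathcal D)$ be the infimum of $W_\rho(\mathcal D,\mathcal D')$ over all perfectly calibrated $\mathcal D'$, where $\rho((f_1,y_1),(f_2,y_2))=d(f_1,f_2)+|y_1-y_2|$. Let $\underline{\mathrm{dCE}}(\mathcal D)$, the standard $\ell_1$ distance to calibration, be the same infimum with $\rho((f_1,y_1),(f_2,y_2))=|f_1-f_2|$ if $y_1=y_2$ and $\infty$ otherwise. Let $\mathrm{wCE}_d(\mathcal D)$ be the supremum of $\mathbb E_{\mathcal D}[(f-y)\,w(f)]$ over all measurable $w:[0,1]\to[-1,1]$ that are $1$-Lipschitz with respect to $d$, and let $\mathrm{wCE}$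 be $\mathrm{wCE}_d$ for $d(u,v)=|u-v|$. A function $\mu$ from distributions to $[0,\infty)$ is a consistent calibration measure if there are constants $c_1,c_2,\alpha_1,\alpha_2>0$ such that $c_1\,\underline{\mathrm{dCE}}(\mathcal D)^{\alpha_1}\le\mu(\mathcal D)\le c_2\,\underline{\mathrm{dCE}}(\mathcal D)^{\alpha_2}$ for all $\mathcal D$. Theorem. Let $c>0$, and consider metrics $d:[0,1]^2\to[0,\infty]$ such that $d(u,v)\le|u-v|\,\varepsilon^{-c}$ for all $\varepsilon>0$ and all $u,v\in[\varepsilon,1-\varepsilon]$. (1) If such a $d$ moreover satisfies $d(u,v)\ge k\,|u-v|$ for some $k>0$ and all $u,v\in[0,1]$, then $\underline{\mathrm{dCE}}_d$ takes finite values and is a consistent calibration measure. (2) There is a constant $C>0$ depending only on $c$ such that, for every such $d$ and every $\mathcal D$, $\mathrm{wCE}_d(\mathcal D)^{q}\le C\,\mathrm{wCE}(\mathcal D)$, where $q=\max(c+1,2)$. -/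

import Mathlib

open MeasureTheory
open scoped ENNReal NNReal

noncomputable section

namespace Calibration

/-- A probability distribution over pairs `(f, y)` of a prediction `f ∈ [0,1]` and a binary
outcome `y ∈ {0,1}`; the outcome is a `Bool`, with `true` standing for `1`. -/
abbrev PredDist : Type := ProbabilityMeasure (unitInterval × Bool)

/-- The numerical value in `{0,1}` of an outcome. -/
def outcome (y : Bool) : ℝ := if y then 1 else 0

/-- `d : [0,1]² → [0,∞]` is a metric (the value `∞` being allowed). -/
structure IsExtMetric (d : unitInterval → unitInterval → ℝ≥0∞) : Prop where
  eq_zero_iff : ∀ u v, d u v = 0 ↔ u = v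
  symm : ∀ u v, d u v = d v u
  triangle : ∀ u v w, d u w ≤ d u v + d v w

/-- `D` is perfectly calibrated: `E[y | f] = f` almost surely. -/
def IsPerfectlyCalibrated (D : PredDist) : Prop :=
  (D : Measure (unitInterval × Bool))[fun p => outcome p.2 |
      MeasurableSpace.comap Prod.fst inferInstance]
    =ᵐ[(D : Measure (unitInterval × Bool))] fun p => (p.1 : ℝ)

/-- The Wasserstein distance between `μ` and `ν` for the (extended-valued) distance `ρ`: the
infimum of `E ρ(x, y)` over all couplings of `μ` and `ν`. -/
def wasserstein {X : Type*} [MeasurableSpace X] (ρ : X → X → ℝ≥0∞)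
    (μ ν : ProbabilityMeasure X) : ℝ≥0∞ :=
  ⨅ γ : {γ : Measure (X × X) //
      γ.map Prod.fst = (μ : Measure X) ∧ γ.map Prod.snd = (ν : Measure X)},
    ∫⁻ z, ρ z.1 z.2 ∂(γ : Measure (X × X))

/-- The Wasserstein distance, for the distance `ρ` on `[0,1] × {0,1}`, from `D` to the set of
perfectly calibrated distributions. -/
def distToCalibrated (ρ : unitInterval × Bool → unitInterval × Bool → ℝ≥0∞)
    (D : PredDist) : ℝ≥0∞ :=
  ⨅ D' : {D' : PredDist // IsPerfectlyCalibrated D'}, wasserstein ρ D D'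

/-- The distance `d(f₁, f₂) + |y₁ - y₂|` on `[0,1] × {0,1}`. -/
def sumDist (d : unitInterval → unitInterval → ℝ≥0∞) (p q : unitInterval × Bool) : ℝ≥0∞ :=
  d p.1 q.1 + ENNReal.ofReal |outcome p.2 - outcome q.2|

/-- The distance on `[0,1] × {0,1}` equal to `|f₁ - f₂|` if `y₁ = y₂` and to `∞` otherwise. -/
def splitDist (p q : unitInterval × Bool) : ℝ≥0∞ :=
  if p.2 = q.2 then ENNReal.ofReal |(p.1 : ℝ) - (q.1 : ℝ)| else ⊤

/-- The distance to calibration `dCE_d` for a metric `d` on the space of predictions. -/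
def dCEWith (d : unitInterval → unitInterval → ℝ≥0∞) (D : PredDist) : ℝ≥0∞ :=
  distToCalibrated (sumDist d) D

/-- The standard (`ℓ₁`) distance to calibration `dCE`. -/
def dCE (D : PredDist) : ℝ≥0∞ :=
  distToCalibrated splitDist D

/-- A calibration score `m` is a consistent calibration measure: it takes finite values, and it is
bounded below and above by constant multiples of positive powers of `dCE`. -/
def IsConsistentCalibrationMeasure (m : PredDist → ℝ≥0∞) : Prop :=
  (∀ D, m D ≠ ⊤) ∧
  ∃ c₁ c₂ : ℝ≥0, ∃ α₁ α₂ : ℝ, 0 < c₁ ∧ 0 < c₂ ∧ 0 < α₁ ∧ 0 < α₂ ∧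
    ∀ D, (c₁ : ℝ≥0∞) * dCE D ^ α₁ ≤ m D ∧ m D ≤ (c₂ : ℝ≥0∞) * dCE D ^ α₂

/-- The usual metric `|u - v|` on `[0,1]`. -/
def stdMetric (u v : unitInterval) : ℝ≥0∞ := ENNReal.ofReal |(u : ℝ) - (v : ℝ)|

/-- The weak calibration error `wCE_d`: the supremum of `E (f - y) w(f)` over the (measurable)
functions `w : [0,1] → [-1,1]` that are `1`-Lipschitz with respect to `d`. The set is non-empty
and bounded above by `1`. -/
def wCEWith (d : unitInterval → unitInterval → ℝ≥0∞) (D : PredDist) : ℝ :=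
  sSup {r : ℝ | ∃ w : unitInterval → ℝ, Measurable w ∧ (∀ u, w u ∈ Set.Icc (-1 : ℝ) 1) ∧
    (∀ u v, ENNReal.ofReal |w u - w v| ≤ d u v) ∧
    r = ∫ p, ((p.1 : ℝ) - outcome p.2) * w p.1 ∂(D : Measure (unitInterval × Bool))}

/-- The standard weak calibration error `wCE`. -/
def wCE (D : PredDist) : ℝ := wCEWith stdMetric D

/-- For all `ε > 0`: `d(u, v) ≤ |u - v| ε⁻ᶜ` for `u, v ∈ [ε, 1 - ε]`. -/
def InteriorBound (c : ℝ) (d : unitInterval → unitInterval → ℝ≥0∞) : Prop :=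
  ∀ ε : ℝ, 0 < ε → ∀ u v : unitInterval,
    (u : ℝ) ∈ Set.Icc ε (1 - ε) → (v : ℝ) ∈ Set.Icc ε (1 - ε) →
      d u v ≤ ENNReal.ofReal (|(u : ℝ) - (v : ℝ)| * ε ^ (-c))

end Calibration

end

namespace Calibration

/-! Calibration says that `y - f` is orthogonal to all bounded functions of `f`, so every estimate
is made by testing against functions of the prediction.

Lower bound in (1): given a coupling with a calibrated `(f', y')`, keep `y` and predict `E[y | f']`.
The extra displacement `E|f' - E[y | f']|` is at most `E|y - y'|`, since conditional expectation
contracts `L¹` (`dCE_le_lintegral`).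

Upper bound in (1): start from a coupling with `y = y'`. As `d` is controlled only in the interior
and may be infinite at the ends, `f` moves to `f'` only when both are interior (`interiorMove`).
Calibration of the new prediction `F` is then restored by flipping outcomes, at cost `E|E[y | F] -
F|` (`dCEWith_le_of_recalibrate`). Not moving near the ends is cheap: for `f'` near `0`, `|y - f'|`
equals `y - f'` up to `O(ε)`, and the latter is killed by calibration of `f'`; similarly near `1`.
Pairs with `f'` well inside but `f` near an end are rare by Markov's inequality.

Part (2) uses the same end effect. A test function that is `d`-Lipschitz is `ε⁻ᶜ`-Lipschitz on `[ε,
1 - ε]`; it is frozen outside, and the error is dominated by hat functions of slope `1/ε` at the two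
ends (`integral_mul_le_of_lipschitz_interior`). Taking `ε` proportional to the tested value absorbs
the `O(ε)` term. -/

/-! ### Calibration as orthogonality to functions of the prediction. -/

lemma measurable_outcome : Measurable outcome := measurable_from_top

lemma outcome_nonneg (y : Bool) : 0 ≤ outcome y := by cases y <;> simp [outcome]

lemma outcome_le_one (y : Bool) : outcome y ≤ 1 := by cases y <;> simp [outcome]

lemma abs_sub_outcome_le_one (u : unitInterval) (y : Bool) : |(u : ℝ) - outcome y| ≤ 1 := by
  have := u.2.1
  have := u.2.2
  have := outcome_nonneg y
  have := outcome_le_one y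
  rw [abs_le]
  constructor <;> linarith

lemma integrable_of_abs_le {Ω : Type*} [MeasurableSpace Ω] {P : Measure Ω} [IsFiniteMeasure P]
    {f : Ω → ℝ} (hf : Measurable f) (C : ℝ) (hC : ∀ ω, |f ω| ≤ C) : Integrable f P :=
  Integrable.of_bound hf.aestronglyMeasurable C (ae_of_all _ hC)

/-- Under a perfectly calibrated distribution, `y - f` is orthogonal to bounded functions of `f`. -/
lemma IsPerfectlyCalibrated.integral_mul_eq_zero {D : PredDist} (h : IsPerfectlyCalibrated D)
    {ψ : unitInterval → ℝ} (hψ : Measurable ψ) (hψ1 : ∀ u, |ψ u| ≤ 1) :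
    ∫ p, (outcome p.2 - p.1) * ψ p.1 ∂(D : Measure (unitInterval × Bool)) = 0 := by
  set μ := (D : Measure (unitInterval × Bool))
  have hm : MeasurableSpace.comap (Prod.fst : unitInterval × Bool → unitInterval) inferInstance ≤
      (inferInstance : MeasurableSpace (unitInterval × Bool)) := measurable_fst.comap_le
  have ho : Measurable fun p : unitInterval × Bool => outcome p.2 :=
    measurable_outcome.comp measurable_snd
  have hw : Measurable fun p : unitInterval × Bool => ψ p.1 := hψ.comp measurable_fst
  have hf : Measurable fun p : unitInterval × Bool => (p.1 : ℝ) :=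
    measurable_subtype_coe.comp measurable_fst
  have hyw : Integrable (fun p : unitInterval × Bool => outcome p.2 * ψ p.1) μ := by
    refine integrable_of_abs_le (ho.mul hw) 1 fun p => ?_
    rw [abs_mul, abs_of_nonneg (outcome_nonneg _)]
    exact mul_le_one₀ (outcome_le_one _) (abs_nonneg _) (hψ1 _)
  have hfw : Integrable (fun p : unitInterval × Bool => (p.1 : ℝ) * ψ p.1) μ := by
    refine integrable_of_abs_le (hf.mul hw) 1 fun p => ?_
    rw [abs_mul, abs_of_nonneg p.1.2.1]
    exact mul_le_one₀ p.1.2.2 (abs_nonneg _) (hψ1 _)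
  have hy : Integrable (fun p : unitInterval × Bool => outcome p.2) μ :=
    integrable_of_abs_le ho 1 fun p => by
      rw [abs_of_nonneg (outcome_nonneg _)]
      exact outcome_le_one _
  have key := condExp_mul_of_stronglyMeasurable_right (μ := μ)
    (m := MeasurableSpace.comap (Prod.fst : unitInterval × Bool → unitInterval) inferInstance)
    (f := fun p => outcome p.2) (g := fun p => ψ p.1)
    (hψ.comp (comap_measurable _)).stronglyMeasurable hyw hy
  have e1 : ∫ p, outcome p.2 * ψ p.1 ∂μ = ∫ p, (p.1 : ℝ) * ψ p.1 ∂μ := by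
    rw [← integral_condExp hm]
    refine integral_congr_ae (key.trans ?_)
    filter_upwards [h] with p hp
    simp only [Pi.mul_apply]
    rw [hp]
  simp_rw [sub_mul]
  rw [integral_sub hyw hfw, e1, sub_self]

/-- A distribution under which `y - f` is orthogonal to bounded functions of `f` is perfectly
calibrated. -/
lemma isPerfectlyCalibrated_of_integral_mul_eq_zero {D : PredDist}
    (h : ∀ ψ : unitInterval → ℝ, Measurable ψ → (∀ u, |ψ u| ≤ 1) →
      ∫ p, (outcome p.2 - p.1) * ψ p.1 ∂(D : Measure (unitInterval × Bool)) = 0) :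
    IsPerfectlyCalibrated D := by
  set μ := (D : Measure (unitInterval × Bool)) with hμ
  have hm : MeasurableSpace.comap (Prod.fst : unitInterval × Bool → unitInterval) inferInstance ≤
      (inferInstance : MeasurableSpace (unitInterval × Bool)) := measurable_fst.comap_le
  have ho : Measurable fun p : unitInterval × Bool => outcome p.2 :=
    measurable_outcome.comp measurable_snd
  have hf : Measurable fun p : unitInterval × Bool => (p.1 : ℝ) :=
    measurable_subtype_coe.comp measurable_fst
  have hy : Integrable (fun p : unitInterval × Bool => outcome p.2) μ :=
    integrable_of_abs_le ho 1 fun p => by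
      rw [abs_of_nonneg (outcome_nonneg _)]
      exact outcome_le_one _
  have hf1 : Integrable (fun p : unitInterval × Bool => (p.1 : ℝ)) μ :=
    integrable_of_abs_le hf 1 fun p => by
      rw [abs_of_nonneg p.1.2.1]
      exact p.1.2.2
  refine (ae_eq_condExp_of_forall_setIntegral_eq hm hy (fun s _ _ => hf1.integrableOn) ?_
    (measurable_subtype_coe.comp
      (comap_measurable _)).stronglyMeasurable.aestronglyMeasurable).symm
  rintro s ⟨A, hA, rfl⟩ -
  have hs : MeasurableSet ((Prod.fst : unitInterval × Bool → unitInterval) ⁻¹' A) :=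
    measurable_fst hA
  -- Sets measurable with respect to `f` are preimages, so indicators of `A` are test functions
  -- enough.
  have := h (A.indicator fun _ => 1) (measurable_const.indicator hA) fun u => by
    by_cases hu : u ∈ A <;> simp [hu]
  symm
  rw [← sub_eq_zero, ← integral_sub hy.integrableOn hf1.integrableOn, ← integral_indicator hs,
    ← this]
  congr 1
  ext p
  by_cases hp : p.1 ∈ A <;> simp [hp, Set.indicator]

/-! ### Couplings from random variables, and conditional probabilities. -/

/-- A coupling realised by random variables bounds the distance to calibration. -/
lemma distToCalibrated_le {Ω : Type*} [MeasurableSpace Ω] (P : Measure Ω) [IsProbabilityMeasure P]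
    (ρ : unitInterval × Bool → unitInterval × Bool → ℝ≥0∞) (D : PredDist)
    {X Z : Ω → unitInterval × Bool} (hX : Measurable X) (hZ : Measurable Z)
    (hD : P.map X = (D : Measure (unitInterval × Bool)))
    (hcal : ∀ ψ : unitInterval → ℝ, Measurable ψ → (∀ u, |ψ u| ≤ 1) →
      ∫ ω, (outcome (Z ω).2 - (Z ω).1) * ψ (Z ω).1 ∂P = 0) :
    distToCalibrated ρ D ≤ ∫⁻ ω, ρ (X ω) (Z ω) ∂P := by
  have : IsProbabilityMeasure (P.map Z) := Measure.isProbabilityMeasure_map hZ.aemeasurable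
  let D' : PredDist := ⟨P.map Z, this⟩
  have hD' : IsPerfectlyCalibrated D' := by
    refine isPerfectlyCalibrated_of_integral_mul_eq_zero fun ψ hψ hψ1 => ?_
    rw [← hcal ψ hψ hψ1]
    exact integral_map hZ.aemeasurable (Measurable.aestronglyMeasurable
      (((measurable_outcome.comp measurable_snd).sub
        (measurable_subtype_coe.comp measurable_fst)).mul (hψ.comp measurable_fst)))
  refine (iInf_le _ ⟨D', hD'⟩).trans ?_
  -- No measurability of `ρ` is available, but only the inequality for the integral against a
  -- pushforward is needed.
  refine (iInf_le _ ⟨P.map fun ω => (X ω, Z ω), ?_, ?_⟩).trans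
    (lintegral_map_le (fun z => ρ z.1 z.2) fun ω => (X ω, Z ω))
  · rw [Measure.map_map measurable_fst (hX.prodMk hZ)]
    exact hD
  · rw [Measure.map_map measurable_snd (hX.prodMk hZ)]
    rfl

/-- A `[0,1]`-valued version of the conditional expectation of a binary outcome given a
prediction. -/
lemma exists_condProb {Ω : Type*} [MeasurableSpace Ω] (P : Measure Ω) [IsProbabilityMeasure P]
    {G : Ω → unitInterval} {Y : Ω → Bool} (hG : Measurable G) (hY : Measurable Y) :
    ∃ e : unitInterval → unitInterval, Measurable e ∧
      ∀ ψ : unitInterval → ℝ, Measurable ψ → (∀ u, |ψ u| ≤ 1) →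
        ∫ ω, (outcome (Y ω) - e (G ω)) * ψ (G ω) ∂P = 0 := by
  let κ := ProbabilityTheory.condDistrib Y G P
  -- The conditional law gives a value in `[0,1]` at every point, where `condExp` would give one
  -- only almost everywhere.
  let e : unitInterval → unitInterval := fun u =>
    ⟨(κ u).real {true}, measureReal_nonneg, measureReal_le_one⟩
  have he : Measurable e :=
    Measurable.subtype_mk ((ProbabilityTheory.Kernel.measurable_coe κ
      (MeasurableSet.singleton true)).ennreal_toReal)
  refine ⟨e, he, fun ψ hψ hψ1 => ?_⟩
  have : IsProbabilityMeasure (P.map G) := Measure.isProbabilityMeasure_map hG.aemeasurable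
  have hm : Measurable fun p : unitInterval × Bool => (outcome p.2 - e p.1) * ψ p.1 :=
    ((measurable_outcome.comp measurable_snd).sub
        (measurable_subtype_coe.comp (he.comp measurable_fst))).mul (hψ.comp measurable_fst)
  have h1 := integral_map (μ := P) (hG.prodMk hY).aemeasurable
    (f := fun p : unitInterval × Bool => (outcome p.2 - e p.1) * ψ p.1) hm.aestronglyMeasurable
  rw [← h1, ← ProbabilityTheory.compProd_map_condDistrib hY.aemeasurable,
    Measure.integral_compProd]
  · rw [← integral_zero unitInterval ℝ (μ := P.map G)]
    congr 1
    ext u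
    have hone : (κ u).real {true} + (κ u).real {false} = 1 := by
      rw [← measureReal_union (by simp) (MeasurableSet.singleton _),
        ← probReal_univ (μ := κ u)]
      congr 1
      ext b
      cases b <;> simp
    change ∫ b, (outcome b - (κ u).real {true}) * ψ u ∂κ u = 0
    rw [integral_fintype Integrable.of_finite]
    simp only [Fintype.sum_bool, outcome, smul_eq_mul, if_true, Bool.false_eq_true, if_false]
    rw [eq_sub_of_add_eq' hone]
    ring
  · refine integrable_of_abs_le hm 1 fun p => ?_
    rw [abs_mul, abs_sub_comm]
    exact mul_le_one₀ (abs_sub_outcome_le_one _ _) (abs_nonneg _) (hψ1 _)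

/-! ### Lower bound: outcomes need not move. -/

/-- The distance to calibration that fixes the outcomes is at most the distance to calibration
that may move them. -/
lemma dCE_le_lintegral {D D' : PredDist} (hD' : IsPerfectlyCalibrated D')
    {γ : Measure ((unitInterval × Bool) × (unitInterval × Bool))}
    (h1 : γ.map Prod.fst = (D : Measure (unitInterval × Bool)))
    (h2 : γ.map Prod.snd = (D' : Measure (unitInterval × Bool))) :
    dCE D ≤ ∫⁻ z, (ENNReal.ofReal |(z.1.1 : ℝ) - z.2.1| +
      ENNReal.ofReal |outcome z.1.2 - outcome z.2.2|) ∂γ := by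
  have hγ : IsProbabilityMeasure γ := by
    have : IsProbabilityMeasure (γ.map Prod.fst) := by rw [h1]; infer_instance
    exact Measure.isProbabilityMeasure_of_map Prod.fst
  have mf : Measurable fun z : (unitInterval × Bool) × (unitInterval × Bool) => z.1.1 := by fun_prop
  have mf' : Measurable fun z : (unitInterval × Bool) × (unitInterval × Bool) => z.2.1 := by
    fun_prop
  have my : Measurable fun z : (unitInterval × Bool) × (unitInterval × Bool) => z.1.2 := by fun_prop
  have my' : Measurable fun z : (unitInterval × Bool) × (unitInterval × Bool) => z.2.2 := by
    fun_prop
  -- `e(f') = E[y | f']` uses the outcome `y` of `D`: the pair `(e(f'), y)` is calibrated and keeps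
  -- `y`.
  obtain ⟨e, he, hortho⟩ := exists_condProb γ mf' my
  refine (distToCalibrated_le γ splitDist D measurable_fst ((he.comp mf').prodMk my) h1
    fun ψ hψ hψ1 => hortho (fun u => ψ (e u)) (hψ.comp he) fun u => hψ1 _).trans ?_
  have mo : Measurable fun z : (unitInterval × Bool) × (unitInterval × Bool) => outcome z.1.2 :=
    measurable_outcome.comp my
  have mo' : Measurable fun z : (unitInterval × Bool) × (unitInterval × Bool) => outcome z.2.2 :=
    measurable_outcome.comp my'
  have me : Measurable fun z : (unitInterval × Bool) × (unitInterval × Bool) => (e z.2.1 : ℝ) :=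
    measurable_subtype_coe.comp (he.comp mf')
  have mF : Measurable fun z : (unitInterval × Bool) × (unitInterval × Bool) => (z.1.1 : ℝ) :=
    measurable_subtype_coe.comp mf
  have mF' : Measurable fun z : (unitInterval × Bool) × (unitInterval × Bool) => (z.2.1 : ℝ) :=
    measurable_subtype_coe.comp mf'
  -- The sign of `f' - e(f')`, a function of `f'` alone.
  let s : unitInterval → ℝ := fun u => if e u ≤ u then 1 else -1
  have hs : Measurable s :=
    Measurable.ite (measurableSet_le he measurable_id) measurable_const measurable_const
  have hs1 : ∀ u, |s u| ≤ 1 := fun u => by simp only [s]; split_ifs <;> simp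
  have ms : Measurable fun z : (unitInterval × Bool) × (unitInterval × Bool) => s z.2.1 :=
    hs.comp mf'
  have h0 : ∫ z, (outcome z.2.2 - z.2.1) * s z.2.1 ∂γ = 0 := by
    have := hD'.integral_mul_eq_zero hs hs1
    rw [← h2] at this
    rw [← this]
    exact (integral_map measurable_snd.aemeasurable (Measurable.aestronglyMeasurable
      (((measurable_outcome.comp measurable_snd).sub
        (measurable_subtype_coe.comp measurable_fst)).mul (hs.comp measurable_fst)))).symm
  have hi1 : Integrable (fun z : (unitInterval × Bool) × (unitInterval × Bool) =>
      |(z.2.1 : ℝ) - e z.2.1|) γ := by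
    refine integrable_of_abs_le (mF'.sub me).abs 1 fun z => ?_
    rw [abs_abs, abs_le]
    constructor <;> linarith [z.2.1.2.1, z.2.1.2.2, (e z.2.1).2.1, (e z.2.1).2.2]
  have hi2 : Integrable (fun z : (unitInterval × Bool) × (unitInterval × Bool) =>
      |outcome z.1.2 - outcome z.2.2|) γ := by
    refine integrable_of_abs_le (mo.sub mo').abs 1 fun z => ?_
    rw [abs_abs, abs_le]
    constructor <;> linarith [outcome_nonneg z.1.2, outcome_nonneg z.2.2, outcome_le_one z.1.2,
      outcome_le_one z.2.2]
  have hi3 : Integrable (fun z : (unitInterval × Bool) × (unitInterval × Bool) =>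
      (outcome z.1.2 - e z.2.1) * s z.2.1) γ := by
    refine integrable_of_abs_le ((mo.sub me).mul ms) 1 fun z => ?_
    rw [abs_mul, abs_sub_comm]
    exact mul_le_one₀ (abs_sub_outcome_le_one _ _) (abs_nonneg _) (hs1 _)
  have hi4 : Integrable (fun z : (unitInterval × Bool) × (unitInterval × Bool) =>
      (outcome z.2.2 - z.2.1) * s z.2.1) γ := by
    refine integrable_of_abs_le ((mo'.sub mF').mul ms) 1 fun z => ?_
    rw [abs_mul, abs_sub_comm]
    exact mul_le_one₀ (abs_sub_outcome_le_one _ _) (abs_nonneg _) (hs1 _)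
  have hi34 : Integrable (fun z : (unitInterval × Bool) × (unitInterval × Bool) =>
      (outcome z.1.2 - e z.2.1) * s z.2.1 - (outcome z.2.2 - z.2.1) * s z.2.1) γ := hi3.sub hi4
  have ma1 : Measurable fun z : (unitInterval × Bool) × (unitInterval × Bool) =>
      |(z.2.1 : ℝ) - e z.2.1| := (mF'.sub me).abs
  have ma2 : Measurable fun z : (unitInterval × Bool) × (unitInterval × Bool) =>
      |outcome z.1.2 - outcome z.2.2| := (mo.sub mo').abs
  have key : ∫ z, |(z.2.1 : ℝ) - e z.2.1| ∂γ ≤ ∫ z, |outcome z.1.2 - outcome z.2.2| ∂γ := by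
    calc ∫ z, |(z.2.1 : ℝ) - e z.2.1| ∂γ
        ≤ ∫ z, (|outcome z.1.2 - outcome z.2.2| + ((outcome z.1.2 - e z.2.1) * s z.2.1 -
            (outcome z.2.2 - z.2.1) * s z.2.1)) ∂γ := by
          -- Multiply `f' - e = (y' - y) + (y - e) - (y' - f')` by the sign `s`; the last two terms
          -- integrate to zero.
          refine integral_mono hi1 (hi2.add hi34) fun z => ?_
          simp only [s]
          split_ifs with h
          · rw [abs_of_nonneg (sub_nonneg.2 (Subtype.coe_le_coe.2 h))]
            linarith [neg_abs_le (outcome z.1.2 - outcome z.2.2)]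
          · rw [abs_of_nonpos (sub_nonpos.2 (Subtype.coe_le_coe.2 (not_le.1 h).le))]
            linarith [le_abs_self (outcome z.1.2 - outcome z.2.2)]
      _ = ∫ z, |outcome z.1.2 - outcome z.2.2| ∂γ := by
          rw [integral_add hi2 hi34, integral_sub hi3 hi4, h0,
            hortho s hs hs1, sub_zero, add_zero]
  calc ∫⁻ z, splitDist z.1 (e z.2.1, z.1.2) ∂γ
      ≤ ∫⁻ z, (ENNReal.ofReal |(z.1.1 : ℝ) - z.2.1| +
          ENNReal.ofReal |(z.2.1 : ℝ) - e z.2.1|) ∂γ := by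
        refine lintegral_mono fun z => ?_
        simp only [splitDist, if_true]
        rw [← ENNReal.ofReal_add (abs_nonneg _) (abs_nonneg _)]
        exact ENNReal.ofReal_le_ofReal (abs_sub_le _ _ _)
    _ = ∫⁻ z, ENNReal.ofReal |(z.1.1 : ℝ) - z.2.1| ∂γ +
          ENNReal.ofReal (∫ z, |(z.2.1 : ℝ) - e z.2.1| ∂γ) := by
        rw [lintegral_add_right _ ma1.ennreal_ofReal,
          ofReal_integral_eq_lintegral_ofReal hi1 (ae_of_all _ fun _ => abs_nonneg _)]
    _ ≤ ∫⁻ z, ENNReal.ofReal |(z.1.1 : ℝ) - z.2.1| ∂γ +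
          ENNReal.ofReal (∫ z, |outcome z.1.2 - outcome z.2.2| ∂γ) := by
        gcongr
    _ = _ := by
        rw [lintegral_add_right _ ma2.ennreal_ofReal,
          ofReal_integral_eq_lintegral_ofReal hi2 (ae_of_all _ fun _ => abs_nonneg _)]

/-- If `d` dominates a multiple of the usual metric, then `dCE_d` dominates a multiple of `dCE`. -/
lemma mul_dCE_le_dCEWith {d : unitInterval → unitInterval → ℝ≥0∞} {k : ℝ≥0} (hk1 : k ≤ 1)
    (hd : ∀ u v : unitInterval, ENNReal.ofReal (k * |(u : ℝ) - v|) ≤ d u v) (D : PredDist) :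
    k * dCE D ≤ dCEWith d D := by
  refine le_iInf fun D' => le_iInf fun γ => ?_
  refine (mul_le_mul_right (dCE_le_lintegral D'.2 γ.2.1 γ.2.2) _).trans ?_
  rw [← lintegral_const_mul' _ _ ENNReal.coe_ne_top]
  refine lintegral_mono fun z => ?_
  simp only [sumDist, mul_add]
  gcongr
  · refine le_trans (le_of_eq ?_) (hd _ _)
    rw [ENNReal.ofReal_mul (NNReal.coe_nonneg k), ENNReal.ofReal_coe_nnreal]
  -- The outcome term of `sumDist` is not scaled by `d`, hence the requirement `k ≤ 1`.
  · exact mul_le_of_le_one_left zero_le (by exact_mod_cast hk1)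

/-- Predicting the constant `E y` is calibrated. Conditioning on a constant function produces this
value as `e 0`. -/
lemma dCE_le_one (D : PredDist) : dCE D ≤ 1 := by
  have mc : Measurable fun _ : unitInterval × Bool => (0 : unitInterval) := measurable_const
  obtain ⟨e, he, hortho⟩ :=
    exists_condProb (D : Measure (unitInterval × Bool)) mc measurable_snd
  refine (distToCalibrated_le _ splitDist D measurable_id ((he.comp mc).prodMk measurable_snd)
    Measure.map_id fun ψ hψ hψ1 => hortho (fun u => ψ (e u)) (hψ.comp he) fun u => hψ1 _).trans ?_
  calc _ ≤ ∫⁻ _, 1 ∂(D : Measure (unitInterval × Bool)) := by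
        refine lintegral_mono fun p => ?_
        simp only [splitDist, id, if_true]
        rw [← ENNReal.ofReal_one]
        refine ENNReal.ofReal_le_ofReal (abs_le.2 ?_)
        simp only [Function.comp]
        constructor <;> linarith [p.1.2.1, p.1.2.2, (e 0).2.1, (e 0).2.2]
    _ = 1 := by simp

/-! ### Resampling the outcomes to fit given predictions. -/

/-- Transition probabilities `a` (from `0` to `1`) and `b` (from `1` to `1`) that turn a Bernoulli
variable of mean `e u` into one of mean `u` and flip it with probability `|u - e u|`. -/
lemma exists_transition {e : unitInterval → unitInterval} (he : Measurable e) :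
    ∃ a b : unitInterval → unitInterval, Measurable a ∧ Measurable b ∧
      (∀ u, (e u : ℝ) * b u + (1 - e u) * a u = u) ∧
      ∀ u, (e u : ℝ) * (1 - b u) + (1 - e u) * a u = |(u : ℝ) - e u| := by
  have meR : Measurable fun u => (e u : ℝ) := measurable_subtype_coe.comp he
  have mid : Measurable fun u : unitInterval => (u : ℝ) := measurable_subtype_coe
  have hset : MeasurableSet {u | e u ≤ u} := measurableSet_le he measurable_id
  let a : unitInterval → unitInterval := fun u =>
    ⟨if e u ≤ u then ((u : ℝ) - e u) / (1 - e u) else 0, by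
      split_ifs with h
      · have h' : (e u : ℝ) ≤ u := h
        exact ⟨div_nonneg (by linarith) (by linarith [(e u).2.2]),
          div_le_one_of_le₀ (by linarith [u.2.2]) (by linarith [(e u).2.2])⟩
      · simp⟩
  let b : unitInterval → unitInterval := fun u =>
    ⟨if e u ≤ u then 1 else (u : ℝ) / e u, by
      split_ifs with h
      · simp
      · have h' : (u : ℝ) < e u := not_le.1 h
        exact ⟨div_nonneg u.2.1 (e u).2.1, div_le_one_of_le₀ h'.le (e u).2.1⟩⟩
  refine ⟨a, b, Measurable.subtype_mk
    (Measurable.ite hset ((mid.sub meR).div (measurable_const.sub meR)) measurable_const),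
    Measurable.subtype_mk (Measurable.ite hset measurable_const (mid.div meR)), ?_, ?_⟩
  all_goals
    intro u
    by_cases h : e u ≤ u
    · have h' : (e u : ℝ) ≤ u := h
      simp only [a, b, h, if_true]
      -- If `e u = 1` the division is by zero, but then `u = 1` and the numerator vanishes too.
      rw [mul_div_cancel_of_imp' fun h1 => by linarith [u.2.2]]
      first | ring1 | (rw [abs_of_nonneg (by linarith)]; ring1)
    · have h' : (u : ℝ) < e u := not_le.1 h
      simp only [a, b, h, if_false]
      have h0 : (e u : ℝ) ≠ 0 := (u.2.1.trans_lt h').ne'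
      first
      | (field_simp; ring1)
      | (rw [abs_of_neg (by linarith)]; field_simp; ring1)

/-- The law of the indicator of `{u ≤ x}` for a uniform variable `u` is Bernoulli of mean `x`. -/
lemma integral_decide_le (g : Bool → ℝ) (x : unitInterval) :
    ∫ u : unitInterval, g (decide (u ≤ x)) = x * g true + (1 - x) * g false := by
  have : ∀ u : unitInterval, g (decide (u ≤ x)) =
      (Set.Iic x).indicator (fun _ => g true - g false) u + g false := fun u => by
    by_cases h : u ≤ x <;> simp [h]
  simp_rw [this]
  rw [integral_add ((integrable_const _).indicator measurableSet_Iic) (integrable_const _),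
    integral_indicator measurableSet_Iic]
  simp only [integral_const, measureReal_restrict_apply_univ, smul_eq_mul, probReal_univ]
  rw [Measure.real, unitInterval.volume_Iic, ENNReal.toReal_ofReal x.2.1]
  ring

/-- Moving the predictions from `F₀` to `F` and then resampling the outcomes. -/
lemma dCEWith_le_of_recalibrate {Ω : Type*} [MeasurableSpace Ω] (P : Measure Ω)
    [IsProbabilityMeasure P] (d : unitInterval → unitInterval → ℝ≥0∞) (D : PredDist)
    {F₀ F : Ω → unitInterval} {Y : Ω → Bool} (hF₀ : Measurable F₀) (hF : Measurable F)
    (hY : Measurable Y) (hD : P.map (fun ω => (F₀ ω, Y ω)) = (D : Measure (unitInterval × Bool)))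
    {b : Ω → ℝ≥0∞} (hb : Measurable b) (hdb : ∀ ω, d (F₀ ω) (F ω) ≤ b ω) {η : ℝ}
    (hη : ∀ s : unitInterval → ℝ, Measurable s → (∀ u, |s u| ≤ 1) →
      ∫ ω, (outcome (Y ω) - F ω) * s (F ω) ∂P ≤ η) :
    dCEWith d D ≤ ∫⁻ ω, b ω ∂P + ENNReal.ofReal η := by
  obtain ⟨e, he, hortho⟩ := exists_condProb P hF hY
  obtain ⟨p, q, hp, hq, hpq, hflip⟩ := exists_transition he
  -- The probability that the new outcome is `1`, given the old outcome and the prediction; an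
  -- independent uniform variable realises it.
  let H : Ω → unitInterval := fun ω => if Y ω then q (F ω) else p (F ω)
  have hH : Measurable H :=
    Measurable.ite (hY (MeasurableSet.singleton true)) (hq.comp hF) (hp.comp hF)
  let Y' : Ω × unitInterval → Bool := fun z => decide (z.2 ≤ H z.1)
  have hY' : Measurable Y' := by
    have : Y' = fun z => if z.2 ≤ H z.1 then true else false := by
      ext z
      simp [Y']
    rw [this]
    exact Measurable.ite (measurableSet_le measurable_snd (hH.comp measurable_fst))
      measurable_const measurable_const
  have hFR : Measurable fun ω => (F ω : ℝ) := measurable_subtype_coe.comp hF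
  have hpR : Measurable fun u => (p u : ℝ) := measurable_subtype_coe.comp hp
  have hqR : Measurable fun u => (q u : ℝ) := measurable_subtype_coe.comp hq
  have hYR : Measurable fun ω => outcome (Y ω) := measurable_outcome.comp hY
  have hYR' : Measurable fun z => outcome (Y' z) := measurable_outcome.comp hY'
  have hpqabs : ∀ u, |(q u : ℝ) - p u| ≤ 1 := fun u => by
    rw [abs_le]
    constructor <;> linarith [(p u).2.1, (p u).2.2, (q u).2.1, (q u).2.2]
  have hint : ∀ ψ : unitInterval → ℝ, Measurable ψ → (∀ u, |ψ u| ≤ 1) →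
      ∀ g : unitInterval → unitInterval, Measurable g →
      Integrable (fun ω => (outcome (Y ω) - g (F ω)) * ψ (F ω)) P := by
    intro ψ hψ hψ1 g hg
    refine integrable_of_abs_le ((hYR.sub (measurable_subtype_coe.comp (hg.comp hF))).mul
      (hψ.comp hF)) 1 fun ω => ?_
    rw [abs_mul, abs_sub_comm]
    exact mul_le_one₀ (abs_sub_outcome_le_one _ _) (abs_nonneg _) (hψ1 _)
  let P' : Measure (Ω × unitInterval) := P.prod volume
  have hcal : ∀ ψ : unitInterval → ℝ, Measurable ψ → (∀ u, |ψ u| ≤ 1) →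
      ∫ z, (outcome (Y' z) - F z.1) * ψ (F z.1) ∂P' = 0 := by
    intro ψ hψ hψ1
    have hi : Integrable (fun z => (outcome (Y' z) - F z.1) * ψ (F z.1)) P' := by
      refine integrable_of_abs_le ((hYR'.sub (hFR.comp measurable_fst)).mul
        (hψ.comp (hF.comp measurable_fst))) 1 fun z => ?_
      rw [abs_mul, abs_sub_comm]
      exact mul_le_one₀ (abs_sub_outcome_le_one _ _) (abs_nonneg _) (hψ1 _)
    -- With the uniform variable integrated out, `H - F = (Y - e)(q - p)`, because `e q + (1 - e) p
    -- = F`.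
    rw [integral_prod _ hi, ← hortho (fun u => ((q u : ℝ) - p u) * ψ u)
      ((hqR.sub hpR).mul hψ) fun u => by
        rw [abs_mul]
        exact mul_le_one₀ (hpqabs u) (abs_nonneg _) (hψ1 u)]
    congr 1
    ext ω
    have h1 := integral_decide_le (fun y => (outcome y - F ω) * ψ (F ω)) (H ω)
    have h2 := hpq (F ω)
    simp only [Y', h1]
    simp only [H, outcome]
    cases Y ω <;> simp only [if_true, Bool.false_eq_true, if_false] <;>
      rw [← sub_eq_zero] <;> linear_combination ψ (F ω) * h2
  have hXm : Measurable fun z : Ω × unitInterval => (F₀ z.1, Y z.1) :=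
    (hF₀.prodMk hY).comp measurable_fst
  have hXmap : P'.map (fun z => (F₀ z.1, Y z.1)) = (D : Measure (unitInterval × Bool)) := by
    rw [← hD]
    have h := Measure.map_map (μ := P') (hF₀.prodMk hY) measurable_fst
    rw [measurePreserving_fst.map_eq] at h
    exact h.symm
  refine (distToCalibrated_le P' (sumDist d) D hXm ((hF.comp measurable_fst).prodMk hY')
    hXmap hcal).trans ?_
  have hfm : Measurable fun z : Ω × unitInterval => |outcome (Y z.1) - outcome (Y' z)| :=
    ((hYR.comp measurable_fst).sub hYR').abs
  have hfi : Integrable (fun z : Ω × unitInterval => |outcome (Y z.1) - outcome (Y' z)|) P' := by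
    refine integrable_of_abs_le hfm 1 fun z => ?_
    rw [abs_abs, abs_le]
    constructor <;> linarith [outcome_nonneg (Y z.1), outcome_le_one (Y z.1),
      outcome_nonneg (Y' z), outcome_le_one (Y' z)]
  -- The sign of `e(F) - F`: the test that turns `E (Y - F) s(F)` into `E|e(F) - F|`.
  let s : unitInterval → ℝ := fun u => if e u ≤ u then -1 else 1
  have hs : Measurable s :=
    Measurable.ite (measurableSet_le he measurable_id) measurable_const measurable_const
  have hs1 : ∀ u, |s u| ≤ 1 := fun u => by simp only [s]; split_ifs <;> simp
  have hflipcost : ∫ z, |outcome (Y z.1) - outcome (Y' z)| ∂P' ≤ η := by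
    have hr : Measurable fun u => 1 - (q u : ℝ) - p u := (measurable_const.sub hqR).sub hpR
    have hr1 : ∀ u, |1 - (q u : ℝ) - p u| ≤ 1 := fun u => by
      rw [abs_le]
      constructor <;> linarith [(p u).2.1, (p u).2.2, (q u).2.1, (q u).2.2]
    -- The flip probability is `p + Y (1 - q - p)`, that is `|F - e| + (Y - e)(1 - q - p)`, and `|F
    -- - e| = (Y - F) s - (Y - e) s`.
    calc ∫ z, |outcome (Y z.1) - outcome (Y' z)| ∂P'
        = ∫ ω, ((outcome (Y ω) - F ω) * s (F ω) - (outcome (Y ω) - e (F ω)) * s (F ω) +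
            (outcome (Y ω) - e (F ω)) * (1 - (q (F ω) : ℝ) - p (F ω))) ∂P := by
          rw [integral_prod _ hfi]
          congr 1
          ext ω
          have h1 := integral_decide_le (fun y => |outcome (Y ω) - outcome y|) (H ω)
          have h2 := hflip (F ω)
          have h3 : |(F ω : ℝ) - e (F ω)| = (e (F ω) - F ω) * s (F ω) := by
            simp only [s]
            split_ifs with h
            · rw [abs_of_nonneg (sub_nonneg.2 (Subtype.coe_le_coe.2 h))]
              ring
            · rw [abs_of_nonpos (sub_nonpos.2 (Subtype.coe_le_coe.2 (not_le.1 h).le))]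
              ring
          rw [h3] at h2
          simp only [Y', h1]
          simp only [H, outcome]
          cases Y ω <;> simp only [if_true, Bool.false_eq_true, if_false, sub_zero, sub_self,
            zero_sub, abs_neg, abs_zero, abs_one] <;> linear_combination h2
      _ = ∫ ω, (outcome (Y ω) - F ω) * s (F ω) ∂P := by
          have hi₀ : Integrable (fun ω => (outcome (Y ω) - F ω) * s (F ω)) P :=
            hint s hs hs1 id measurable_id
          have hi : Integrable (fun ω => (outcome (Y ω) - F ω) * s (F ω) -
              (outcome (Y ω) - e (F ω)) * s (F ω)) P := hi₀.sub (hint s hs hs1 e he)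
          rw [integral_add hi (hint _ hr hr1 e he), integral_sub hi₀ (hint s hs hs1 e he),
            hortho s hs hs1, hortho _ hr hr1]
          simp
      _ ≤ η := hη s hs hs1
  -- `d` need not be measurable, so its measurable majorant `b` is the one integrated over the
  -- product.
  calc ∫⁻ z, sumDist d (F₀ z.1, Y z.1) (F z.1, Y' z) ∂P'
      ≤ ∫⁻ z, (b z.1 + ENNReal.ofReal |outcome (Y z.1) - outcome (Y' z)|) ∂P' :=
        lintegral_mono fun z => add_le_add_left (hdb z.1) _
    _ = ∫⁻ ω, b ω ∂P + ENNReal.ofReal (∫ z, |outcome (Y z.1) - outcome (Y' z)| ∂P') := by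
        rw [lintegral_add_right _ hfm.ennreal_ofReal,
          ofReal_integral_eq_lintegral_ofReal hfi (ae_of_all _ fun _ => abs_nonneg _),
          measurePreserving_fst.lintegral_comp hb]
    _ ≤ ∫⁻ ω, b ω ∂P + ENNReal.ofReal η := by gcongr

/-! ### Upper bound: moving predictions in the interior only. -/

lemma measurable_splitDist : Measurable fun z : (unitInterval × Bool) × (unitInterval × Bool) =>
    splitDist z.1 z.2 := by
  refine Measurable.ite ?_ ?_ measurable_const
  · exact measurableSet_eq_fun (measurable_snd.comp measurable_fst)
      (measurable_snd.comp measurable_snd)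
  · exact (((measurable_subtype_coe.comp (measurable_fst.comp measurable_fst)).sub
      (measurable_subtype_coe.comp (measurable_fst.comp measurable_snd))).abs).ennreal_ofReal

/-- The prediction `f` is moved to `f'` if both are safely in the interior, and kept otherwise. -/
noncomputable def interiorMove (ε : ℝ) (z : unitInterval × unitInterval) : unitInterval :=
  if ((z.1 : ℝ) ∈ Set.Icc ε (1 - ε)) ∧ (z.2 : ℝ) ∈ Set.Icc (2 * ε) (1 - 2 * ε) then z.2 else z.1

lemma measurable_interiorMove (ε : ℝ) : Measurable (interiorMove ε) := by
  refine Measurable.ite (MeasurableSet.inter ?_ ?_) measurable_snd measurable_fst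
  · exact (measurable_subtype_coe.comp measurable_fst) measurableSet_Icc
  · exact (measurable_subtype_coe.comp measurable_snd) measurableSet_Icc

/-- A test function `s` of the moved predictions is compared with the test function of `f'` that
equals `1` near `0`, `-1` near `1` and `s` in between. -/
lemma outcome_sub_interiorMove_mul_le {ε : ℝ} (hε : 0 < ε) {s : unitInterval → ℝ}
    (hs : ∀ u, |s u| ≤ 1) (f f' : unitInterval) (y : Bool) :
    (outcome y - interiorMove ε (f, f')) * s (interiorMove ε (f, f')) ≤
      (outcome y - f') * (if (f' : ℝ) < 2 * ε then 1 else if 1 - 2 * ε < (f' : ℝ) then -1 else s f')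
        + (4 * ε + (1 + 2 / ε) * |(f : ℝ) - f'|) := by
  have hab : ∀ u v : unitInterval, (outcome y - u) * s v ≤ |outcome y - u| := fun u v => by
    refine (le_abs_self _).trans ?_
    rw [abs_mul]
    exact mul_le_of_le_one_right (abs_nonneg _) (hs v)
  have hpos : 0 ≤ 2 / ε * |(f : ℝ) - f'| := by positivity
  have htri := abs_sub_le (outcome y) (f' : ℝ) f
  rw [abs_sub_comm (f' : ℝ) f] at htri
  have hf := f.2.1
  have hf' := f'.2.1
  have hf1 := f.2.2
  have hf1' := f'.2.2
  have hy := outcome_nonneg y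
  have hy1 := outcome_le_one y
  by_cases h1 : (f' : ℝ) < 2 * ε
  · have hF : interiorMove ε (f, f') = f := if_neg fun h => by linarith [h.2.1]
    rw [hF, if_pos h1]
    have h2 : |outcome y - f'| ≤ outcome y - f' + 4 * ε := by
      rw [abs_le]
      constructor <;> linarith
    linarith [hab f f]
  by_cases h2 : 1 - 2 * ε < (f' : ℝ)
  · have hF : interiorMove ε (f, f') = f := if_neg fun h => by linarith [h.2.2]
    rw [hF, if_neg h1, if_pos h2]
    have h3 : |outcome y - f'| ≤ f' - outcome y + 4 * ε := by
      rw [abs_le]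
      constructor <;> linarith
    linarith [hab f f]
  rw [if_neg h1, if_neg h2]
  by_cases h3 : (f : ℝ) ∈ Set.Icc ε (1 - ε)
  · have hF : interiorMove ε (f, f') = f' := if_pos ⟨h3, not_lt.1 h1, not_lt.1 h2⟩
    rw [hF]
    linarith [abs_nonneg ((f : ℝ) - f')]
  · have hF : interiorMove ε (f, f') = f := if_neg fun h => h3 h.1
    rw [hF]
    -- The gap between the thresholds `ε` for `f` and `2ε` for `f'` makes this a Markov-type case,
    -- paid for by the term `2/ε * |f - f'|`.
    have h4 : ε ≤ |(f : ℝ) - f'| := by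
      by_contra! h5
      rw [abs_lt] at h5
      exact h3 ⟨by linarith, by linarith⟩
    have h5 : 2 ≤ 2 / ε * |(f : ℝ) - f'| := by
      rw [div_mul_eq_mul_div, le_div_iff₀ hε]
      linarith
    have h6 : |outcome y - f| ≤ 1 := by
      rw [abs_sub_comm]
      exact abs_sub_outcome_le_one _ _
    have h7 : -1 ≤ (outcome y - f') * s f' := by
      have : |(outcome y - f') * s f'| ≤ 1 := by
        rw [abs_mul, abs_sub_comm]
        exact mul_le_one₀ (abs_sub_outcome_le_one _ _) (abs_nonneg _) (hs _)
      exact (abs_le.1 this).1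
    linarith [hab f f, abs_nonneg ((f : ℝ) - f')]

/-- With `δ = 2 ε ^ (c + 2)`, moving costs `ε⁻ᶜ δ = 2ε²` and flipping costs `4ε + (1 + 2/ε) δ ≤ 8ε +
2ε²`. The factor `2` leaves room for a strict inequality when `dCE D = ε ^ (c + 2)`. -/
lemma dCEWith_le_of_dCE_lt {c : ℝ} (hc : 0 < c) {d : unitInterval → unitInterval → ℝ≥0∞}
    (hd : IsExtMetric d) (hI : InteriorBound c d) {D : PredDist} {ε : ℝ} (hε : 0 < ε) (hε1 : ε ≤ 1)
    (h : dCE D < ENNReal.ofReal (2 * ε ^ (c + 2))) :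
    dCEWith d D ≤ ENNReal.ofReal (12 * ε) := by
  obtain ⟨⟨D', hD'⟩, h⟩ := iInf_lt_iff.1 h
  obtain ⟨⟨γ, h1, h2⟩, h⟩ := iInf_lt_iff.1 h
  simp only at h h2
  set δ := 2 * ε ^ (c + 2) with hδ
  have hδ0 : 0 < δ := by positivity
  have hγ : IsProbabilityMeasure γ := by
    have : IsProbabilityMeasure (γ.map Prod.fst) := by rw [h1]; infer_instance
    exact Measure.isProbabilityMeasure_of_map Prod.fst
  have mf : Measurable fun z : (unitInterval × Bool) × (unitInterval × Bool) => z.1.1 := by fun_prop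
  have mf' : Measurable fun z : (unitInterval × Bool) × (unitInterval × Bool) => z.2.1 := by
    fun_prop
  have my : Measurable fun z : (unitInterval × Bool) × (unitInterval × Bool) => z.1.2 := by fun_prop
  have mo' : Measurable fun z : (unitInterval × Bool) × (unitInterval × Bool) => outcome z.2.2 :=
    measurable_outcome.comp (measurable_snd.comp measurable_snd)
  have mΔ : Measurable fun z : (unitInterval × Bool) × (unitInterval × Bool) =>
      |(z.1.1 : ℝ) - z.2.1| :=
    ((measurable_subtype_coe.comp mf).sub (measurable_subtype_coe.comp mf')).abs
  have iΔ : Integrable (fun z : (unitInterval × Bool) × (unitInterval × Bool) =>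
      |(z.1.1 : ℝ) - z.2.1|) γ := by
    refine integrable_of_abs_le mΔ 1 fun z => ?_
    rw [abs_abs, abs_le]
    constructor <;> linarith [z.1.1.2.1, z.1.1.2.2, z.2.1.2.1, z.2.1.2.2]
  -- Finite cost for `splitDist` forbids changing an outcome.
  have hae : ∀ᵐ z ∂γ, z.1.2 = z.2.2 := by
    filter_upwards [ae_lt_top measurable_splitDist (h.trans_le le_top).ne] with z hz
    by_contra hne
    simp [splitDist, hne] at hz
  have hlΔ : ∫⁻ z, ENNReal.ofReal |(z.1.1 : ℝ) - z.2.1| ∂γ ≤ ENNReal.ofReal δ := by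
    refine le_trans (lintegral_mono fun z => ?_) h.le
    simp only [splitDist]
    split_ifs
    exacts [le_rfl, le_top]
  have hΔ : ∫ z, |(z.1.1 : ℝ) - z.2.1| ∂γ ≤ δ := by
    rw [← ofReal_integral_eq_lintegral_ofReal iΔ (ae_of_all _ fun _ => abs_nonneg _)] at hlΔ
    exact (ENNReal.ofReal_le_ofReal_iff hδ0.le).1 hlΔ
  have mF : Measurable fun z : (unitInterval × Bool) × (unitInterval × Bool) =>
      interiorMove ε (z.1.1, z.2.1) := (measurable_interiorMove ε).comp (mf.prodMk mf')
  have hη : ∀ s : unitInterval → ℝ, Measurable s → (∀ u, |s u| ≤ 1) →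
      ∫ z, (outcome z.1.2 - interiorMove ε (z.1.1, z.2.1)) * s (interiorMove ε (z.1.1, z.2.1)) ∂γ ≤
        4 * ε + (1 + 2 / ε) * δ := by
    intro s hs hs1
    let ψ : unitInterval → ℝ := fun u =>
      if (u : ℝ) < 2 * ε then 1 else if 1 - 2 * ε < (u : ℝ) then -1 else s u
    have hψ : Measurable ψ := by
      refine Measurable.ite (measurableSet_lt measurable_subtype_coe measurable_const)
        measurable_const (Measurable.ite (measurableSet_lt measurable_const measurable_subtype_coe)
        measurable_const hs)
    have hψ1 : ∀ u, |ψ u| ≤ 1 := fun u => by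
      simp only [ψ]
      split_ifs
      exacts [by simp, by simp, hs1 u]
    have h0 : ∫ z, (outcome z.2.2 - z.2.1) * ψ z.2.1 ∂γ = 0 := by
      have := hD'.integral_mul_eq_zero hψ hψ1
      rw [← h2] at this
      rw [← this]
      exact (integral_map measurable_snd.aemeasurable (Measurable.aestronglyMeasurable
        (((measurable_outcome.comp measurable_snd).sub
          (measurable_subtype_coe.comp measurable_fst)).mul (hψ.comp measurable_fst)))).symm
    have i1 : Integrable (fun z : (unitInterval × Bool) × (unitInterval × Bool) =>
        (outcome z.1.2 - interiorMove ε (z.1.1, z.2.1)) * s (interiorMove ε (z.1.1, z.2.1))) γ := by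
      refine integrable_of_abs_le (((measurable_outcome.comp my).sub
        (measurable_subtype_coe.comp mF)).mul (hs.comp mF)) 1 fun z => ?_
      rw [abs_mul, abs_sub_comm]
      exact mul_le_one₀ (abs_sub_outcome_le_one _ _) (abs_nonneg _) (hs1 _)
    have i2 : Integrable (fun z : (unitInterval × Bool) × (unitInterval × Bool) =>
        (outcome z.2.2 - z.2.1) * ψ z.2.1) γ := by
      refine integrable_of_abs_le ((mo'.sub
        (measurable_subtype_coe.comp mf')).mul (hψ.comp mf')) 1 fun z => ?_
      rw [abs_mul, abs_sub_comm]
      exact mul_le_one₀ (abs_sub_outcome_le_one _ _) (abs_nonneg _) (hψ1 _)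
    have i3 : Integrable (fun z : (unitInterval × Bool) × (unitInterval × Bool) =>
        4 * ε + (1 + 2 / ε) * |(z.1.1 : ℝ) - z.2.1|) γ :=
      (integrable_const _).add (iΔ.const_mul _)
    calc _ ≤ ∫ z, ((outcome z.2.2 - z.2.1) * ψ z.2.1 +
          (4 * ε + (1 + 2 / ε) * |(z.1.1 : ℝ) - z.2.1|)) ∂γ := by
          refine integral_mono_ae i1 (i2.add i3) ?_
          filter_upwards [hae] with z hz
          rw [← hz]
          exact outcome_sub_interiorMove_mul_le hε hs1 _ _ _
      _ = 4 * ε + (1 + 2 / ε) * ∫ z, |(z.1.1 : ℝ) - z.2.1| ∂γ := by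
          rw [integral_add i2 i3, h0, integral_add (integrable_const _) (iΔ.const_mul _),
            integral_const_mul (1 + 2 / ε)]
          simp
      _ ≤ _ := by gcongr
  refine (dCEWith_le_of_recalibrate γ d D mf mF my h1
    (b := fun z => ENNReal.ofReal (ε ^ (-c)) * ENNReal.ofReal |(z.1.1 : ℝ) - z.2.1|)
    (mΔ.ennreal_ofReal.const_mul _) (fun z => ?_) hη).trans ?_
  · unfold interiorMove
    split_ifs with hz
    · refine (hI ε hε _ _ hz.1 ⟨?_, ?_⟩).trans (le_of_eq ?_)
      · linarith [hz.2.1]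
      · linarith [hz.2.2]
      · rw [mul_comm, ENNReal.ofReal_mul (by positivity)]
    · rw [(hd.eq_zero_iff _ _).2 rfl]
      exact zero_le
  · rw [lintegral_const_mul _ mΔ.ennreal_ofReal]
    calc _ ≤ ENNReal.ofReal (ε ^ (-c)) * ENNReal.ofReal δ +
          ENNReal.ofReal (4 * ε + (1 + 2 / ε) * δ) := by gcongr
      _ = ENNReal.ofReal (ε ^ (-c) * δ + (4 * ε + (1 + 2 / ε) * δ)) := by
          rw [← ENNReal.ofReal_mul (by positivity), ← ENNReal.ofReal_add (by positivity)
            (by positivity)]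
      _ ≤ _ := by
          refine ENNReal.ofReal_le_ofReal ?_
          have e1 : ε ^ (-c) * δ = 2 * ε ^ 2 := by
            rw [hδ, mul_left_comm, ← Real.rpow_add hε, ← Real.rpow_natCast]
            norm_num
          have e2 : δ ≤ 2 * ε ^ 2 := by
            have := Real.rpow_le_rpow_of_exponent_ge hε hε1 (by linarith : (2 : ℝ) ≤ c + 2)
            rw [hδ, ← Real.rpow_natCast]
            push_cast
            linarith
          have e3 : (1 + 2 / ε) * δ ≤ 2 * ε ^ 2 + 4 * ε := by
            calc (1 + 2 / ε) * δ ≤ (1 + 2 / ε) * (2 * ε ^ 2) := by gcongr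
              _ = _ := by field_simp; ring
          nlinarith

lemma dCEWith_le_rpow_dCE {c : ℝ} (hc : 0 < c) {d : unitInterval → unitInterval → ℝ≥0∞}
    (hd : IsExtMetric d) (hI : InteriorBound c d) (D : PredDist) :
    dCEWith d D ≤ (12 : ℝ≥0) * dCE D ^ (1 / (c + 2)) := by
  have hfin : dCE D ≠ ⊤ := ((dCE_le_one D).trans_lt ENNReal.one_lt_top).ne
  rcases eq_or_ne (dCE D) 0 with h0 | h0
  · have hz : dCEWith d D ≤ 0 := by
      refine ENNReal.le_of_forall_pos_le_add fun ε hε _ => ?_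
      have hε' : 0 < min 1 ((ε : ℝ) / 12) := lt_min one_pos (by positivity)
      refine (dCEWith_le_of_dCE_lt hc hd hI hε' (min_le_left _ _) ?_).trans ?_
      · rw [h0]
        exact ENNReal.ofReal_pos.2 (by positivity)
      · rw [zero_add, ← ENNReal.ofReal_coe_nnreal]
        refine ENNReal.ofReal_le_ofReal ?_
        linarith [min_le_right 1 ((ε : ℝ) / 12)]
    exact hz.trans zero_le
  · set x := (dCE D).toReal with hx
    have hx0 : 0 < x := ENNReal.toReal_pos h0 hfin
    have hx1 : x ≤ 1 := by
      rw [hx, ← ENNReal.toReal_one]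
      exact ENNReal.toReal_mono ENNReal.one_ne_top (dCE_le_one D)
    have hxD : dCE D = ENNReal.ofReal x := (ENNReal.ofReal_toReal hfin).symm
    have hc2 : 0 < c + 2 := by linarith
    refine (dCEWith_le_of_dCE_lt hc hd hI (Real.rpow_pos_of_pos hx0 (1 / (c + 2)))
      (Real.rpow_le_one hx0.le hx1 (by positivity)) ?_).trans (le_of_eq ?_)
    · rw [hxD, ← Real.rpow_mul hx0.le, one_div_mul_cancel hc2.ne', Real.rpow_one]
      exact (ENNReal.ofReal_lt_ofReal_iff (by positivity)).2 (by linarith)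
    · rw [hxD, ENNReal.ofReal_rpow_of_pos hx0, ENNReal.ofReal_mul (by norm_num)]
      norm_num

lemma isConsistentCalibrationMeasure_dCEWith {c : ℝ} (hc : 0 < c)
    {d : unitInterval → unitInterval → ℝ≥0∞} (hd : IsExtMetric d)
    (hk : ∃ k : ℝ, 0 < k ∧
      ∀ u v : unitInterval, ENNReal.ofReal (k * |(u : ℝ) - (v : ℝ)|) ≤ d u v)
    (hI : InteriorBound c d) : IsConsistentCalibrationMeasure (dCEWith d) := by
  obtain ⟨k, hk0, hk⟩ := hk
  have hc2 : 0 < 1 / (c + 2) := by positivity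
  constructor
  · intro D
    refine ((dCEWith_le_rpow_dCE hc hd hI D).trans_lt (ENNReal.mul_lt_top ENNReal.coe_lt_top ?_)).ne
    exact ENNReal.rpow_lt_top_of_nonneg hc2.le ((dCE_le_one D).trans_lt ENNReal.one_lt_top).ne
  · refine ⟨min 1 k.toNNReal, 12, 1, 1 / (c + 2), lt_min one_pos (Real.toNNReal_pos.2 hk0),
      by norm_num, one_pos, hc2, fun D => ⟨?_, dCEWith_le_rpow_dCE hc hd hI D⟩⟩
    rw [ENNReal.rpow_one]
    refine mul_dCE_le_dCEWith (min_le_left _ _) (fun u v => le_trans ?_ (hk u v)) D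
    refine ENNReal.ofReal_le_ofReal (mul_le_mul_of_nonneg_right ?_ (abs_nonneg _))
    calc ((min 1 k.toNNReal : ℝ≥0) : ℝ) ≤ (k.toNNReal : ℝ) :=
          NNReal.coe_le_coe.2 (min_le_right _ _)
      _ = k := Real.coe_toNNReal k hk0.le

/-! ### Weak calibration error. -/

lemma abs_integral_mul_le_one (D : PredDist) {w : unitInterval → ℝ}
    (hw : ∀ u, w u ∈ Set.Icc (-1 : ℝ) 1) :
    |∫ p, ((p.1 : ℝ) - outcome p.2) * w p.1 ∂(D : Measure (unitInterval × Bool))| ≤ 1 := by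
  have := norm_integral_le_of_norm_le_const (μ := (D : Measure (unitInterval × Bool)))
    (f := fun p : unitInterval × Bool => ((p.1 : ℝ) - outcome p.2) * w p.1) (C := 1)
    (ae_of_all _ fun p => by
      rw [Real.norm_eq_abs, abs_mul]
      exact mul_le_one₀ (abs_sub_outcome_le_one _ _) (abs_nonneg _) (abs_le.2 (hw _)))
  simpa using this

lemma integrable_sub_outcome_mul (D : PredDist) {w : unitInterval → ℝ} (hwm : Measurable w)
    (hw : ∀ u, w u ∈ Set.Icc (-1 : ℝ) 1) :
    Integrable (fun p : unitInterval × Bool => ((p.1 : ℝ) - outcome p.2) * w p.1)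
      (D : Measure (unitInterval × Bool)) := by
  refine integrable_of_abs_le (((measurable_subtype_coe.comp measurable_fst).sub
    (measurable_outcome.comp measurable_snd)).mul (hwm.comp measurable_fst)) 1 fun p => ?_
  rw [abs_mul]
  exact mul_le_one₀ (abs_sub_outcome_le_one _ _) (abs_nonneg _) (abs_le.2 (hw _))

lemma bddAbove_wCEWith (d : unitInterval → unitInterval → ℝ≥0∞) (D : PredDist) :
    BddAbove {r : ℝ | ∃ w : unitInterval → ℝ, Measurable w ∧ (∀ u, w u ∈ Set.Icc (-1 : ℝ) 1) ∧
      (∀ u v, ENNReal.ofReal |w u - w v| ≤ d u v) ∧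
      r = ∫ p, ((p.1 : ℝ) - outcome p.2) * w p.1 ∂(D : Measure (unitInterval × Bool))} := by
  refine ⟨1, ?_⟩
  rintro r ⟨w, -, hw, -, rfl⟩
  exact (le_abs_self _).trans (abs_integral_mul_le_one D hw)

lemma wCEWith_nonneg (d : unitInterval → unitInterval → ℝ≥0∞) (D : PredDist) :
    0 ≤ wCEWith d D :=
  le_csSup (bddAbove_wCEWith d D) ⟨fun _ => 0, measurable_const, by simp, by simp, by simp⟩

/-- Testing against a Lipschitz function costs at most its Lipschitz constant. -/
lemma integral_mul_le_mul_wCE (D : PredDist) {w : unitInterval → ℝ} (hwm : Measurable w)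
    (hw : ∀ u, w u ∈ Set.Icc (-1 : ℝ) 1) {K : ℝ} (hK : 1 ≤ K)
    (hwK : ∀ u v : unitInterval, |w u - w v| ≤ K * |(u : ℝ) - v|) :
    ∫ p, ((p.1 : ℝ) - outcome p.2) * w p.1 ∂(D : Measure (unitInterval × Bool)) ≤ K * wCE D := by
  have hK0 : 0 < K := by linarith
  rw [← div_le_iff₀' hK0]
  refine le_csSup (bddAbove_wCEWith _ D) ⟨fun u => w u / K, hwm.div_const K, fun u => ?_,
    fun u v => ?_, ?_⟩
  · refine abs_le.1 ?_
    rw [abs_div, abs_of_pos hK0]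
    exact div_le_one_of_le₀ ((abs_le.2 (hw u)).trans hK) hK0.le
  · refine ENNReal.ofReal_le_ofReal ?_
    rw [← sub_div, abs_div, abs_of_pos hK0, div_le_iff₀' hK0]
    exact hwK u v
  · rw [← integral_div]
    congr 1
    ext p
    ring

/-- The piecewise linear function equal to `1` on `[0, ε]` and to `0` on `[2ε, 1]`. -/
noncomputable def endHat (ε : ℝ) (u : unitInterval) : ℝ := max 0 (min 1 (2 - u / ε))

lemma endHat_nonneg (ε : ℝ) (u : unitInterval) : 0 ≤ endHat ε u := le_max_left _ _

lemma endHat_le_one (ε : ℝ) (u : unitInterval) : endHat ε u ≤ 1 :=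
  max_le zero_le_one (min_le_left _ _)

lemma measurable_endHat (ε : ℝ) : Measurable (endHat ε) :=
  measurable_const.max (measurable_const.min
    (measurable_const.sub (measurable_subtype_coe.div_const ε)))

lemma abs_endHat_sub_le {ε : ℝ} (hε : 0 < ε) (u v : unitInterval) :
    |endHat ε u - endHat ε v| ≤ 1 / ε * |(u : ℝ) - v| := by
  unfold endHat
  refine (abs_max_sub_max_le_max _ _ _ _).trans ?_
  rw [sub_self, abs_zero, max_eq_right (abs_nonneg _)]
  refine (abs_min_sub_min_le_max _ _ _ _).trans ?_
  rw [sub_self, abs_zero, max_eq_right (abs_nonneg _), sub_sub_sub_cancel_left, ← sub_div, abs_div,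
    abs_of_pos hε, abs_sub_comm, one_div_mul_eq_div]

lemma endHat_of_le {ε : ℝ} (hε : 0 < ε) {u : unitInterval} (hu : (u : ℝ) ≤ ε) :
    endHat ε u = 1 := by
  have : (u : ℝ) / ε ≤ 1 := div_le_one_of_le₀ hu hε.le
  rw [endHat, min_eq_left (by linarith), max_eq_right zero_le_one]

lemma mul_endHat_le {ε : ℝ} (hε : 0 < ε) (u : unitInterval) : u * endHat ε u ≤ 2 * ε := by
  by_cases h : (u : ℝ) ≤ 2 * ε
  · calc u * endHat ε u ≤ u * 1 := mul_le_mul_of_nonneg_left (endHat_le_one _ _) u.2.1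
      _ ≤ 2 * ε := by linarith
  · have : 2 ≤ (u : ℝ) / ε := (le_div_iff₀ hε).2 (not_le.1 h).le
    rw [endHat, max_eq_left ((min_le_right _ _).trans (by linarith))]
    linarith

/-- The contribution of the predictions near `0` to a test is controlled by that of a hat
function. -/
lemma abs_sub_outcome_mul_endHat_le {ε : ℝ} (hε : 0 < ε) (u : unitInterval) (y : Bool) :
    |(u : ℝ) - outcome y| * endHat ε u ≤ -((u - outcome y) * endHat ε u) + 4 * ε := by
  have h1 : |(u : ℝ) - outcome y| ≤ outcome y + u := by
    rw [abs_le]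
    constructor <;> linarith [u.2.1, outcome_nonneg y]
  have h2 := mul_le_mul_of_nonneg_right h1 (endHat_nonneg ε u)
  have h3 := mul_endHat_le hε u
  linarith

/-- The contribution of the predictions near `1` to a test is controlled by that of a hat
function. -/
lemma abs_sub_outcome_mul_endHat_symm_le {ε : ℝ} (hε : 0 < ε) (u : unitInterval) (y : Bool) :
    |(u : ℝ) - outcome y| * endHat ε (unitInterval.symm u) ≤
      (u - outcome y) * endHat ε (unitInterval.symm u) + 4 * ε := by
  have h1 : |(u : ℝ) - outcome y| ≤ (u - outcome y) + 2 * unitInterval.symm u := by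
    rw [unitInterval.coe_symm_eq, abs_le]
    constructor <;> linarith [u.2.2, outcome_le_one y]
  have h2 := mul_le_mul_of_nonneg_right h1 (endHat_nonneg ε (unitInterval.symm u))
  have h3 := mul_endHat_le hε (unitInterval.symm u)
  linarith

/-- Tests that are Lipschitz with constant `K` on `[ε, 1 - ε]`. -/
lemma integral_mul_le_of_lipschitz_interior (D : PredDist) {w : unitInterval → ℝ}
    (hwm : Measurable w) (hw : ∀ u, w u ∈ Set.Icc (-1 : ℝ) 1) {ε K : ℝ} (hε : 0 < ε)
    (hε2 : ε ≤ 1 / 2) (hK : 1 ≤ K)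
    (hwK : ∀ u v : unitInterval, (u : ℝ) ∈ Set.Icc ε (1 - ε) → (v : ℝ) ∈ Set.Icc ε (1 - ε) →
      |w u - w v| ≤ K * |(u : ℝ) - v|) :
    ∫ p, ((p.1 : ℝ) - outcome p.2) * w p.1 ∂(D : Measure (unitInterval × Bool)) ≤
      (K + 4 / ε) * wCE D + 16 * ε := by
  have hle : ε ≤ 1 - ε := by linarith
  -- Clamping to `[ε, 1 - ε]` extends the interior Lipschitz bound on `w` to all of `[0,1]`.
  let π : unitInterval → unitInterval := fun u =>
    ⟨Set.projIcc ε (1 - ε) hle u, by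
      have := (Set.projIcc ε (1 - ε) hle u).2
      exact ⟨by linarith [this.1], by linarith [this.2]⟩⟩
  have hπ : Measurable π :=
    Measurable.subtype_mk (measurable_subtype_coe.comp
      ((continuous_projIcc (h := hle)).measurable.comp measurable_subtype_coe))
  have hπmem : ∀ u, (π u : ℝ) ∈ Set.Icc ε (1 - ε) := fun u => (Set.projIcc ε (1 - ε) hle u).2
  have hπid : ∀ u : unitInterval, (u : ℝ) ∈ Set.Icc ε (1 - ε) → π u = u := fun u hu =>
    Subtype.ext (by simp only [π]; rw [Set.projIcc_of_mem hle hu])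
  have hw' : ∀ u, w (π u) ∈ Set.Icc (-1 : ℝ) 1 := fun u => hw _
  have hwm' : Measurable fun u => w (π u) := hwm.comp hπ
  have hlip : ∀ u v : unitInterval, |w (π u) - w (π v)| ≤ K * |(u : ℝ) - v| := fun u v => by
    refine (hwK _ _ (hπmem u) (hπmem v)).trans ?_
    exact mul_le_mul_of_nonneg_left (Set.abs_projIcc_sub_projIcc hle) (by linarith)
  have hφ : ∀ u, -endHat ε u ∈ Set.Icc (-1 : ℝ) 1 := fun u =>
    ⟨by linarith [endHat_le_one ε u], by linarith [endHat_nonneg ε u]⟩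
  have hφ' : ∀ u, endHat ε (unitInterval.symm u) ∈ Set.Icc (-1 : ℝ) 1 := fun u =>
    ⟨by linarith [endHat_nonneg ε (unitInterval.symm u)], endHat_le_one _ _⟩
  have hφm : Measurable fun u => -endHat ε u := (measurable_endHat ε).neg
  have hφm' : Measurable fun u => endHat ε (unitInterval.symm u) :=
    (measurable_endHat ε).comp unitInterval.measurable_symm
  have hε1 : 1 ≤ 1 / ε := (le_div_iff₀ hε).2 (by linarith)
  have t0 := integral_mul_le_mul_wCE D hwm' hw' hK hlip
  have t1 := integral_mul_le_mul_wCE D hφm hφ hε1 fun u v => by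
    rw [neg_sub_neg, abs_sub_comm]
    exact abs_endHat_sub_le hε u v
  have t2 := integral_mul_le_mul_wCE D hφm' hφ' hε1 fun u v => by
    refine (abs_endHat_sub_le hε _ _).trans (le_of_eq ?_)
    rw [unitInterval.coe_symm_eq, unitInterval.coe_symm_eq, sub_sub_sub_cancel_left, abs_sub_comm]
  have i0 := integrable_sub_outcome_mul D hwm' hw'
  have i1 := integrable_sub_outcome_mul D hφm hφ
  have i2 := integrable_sub_outcome_mul D hφm' hφ'
  have i12 : Integrable (fun p : unitInterval × Bool =>
      2 * (((p.1 : ℝ) - outcome p.2) * -endHat ε p.1) +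
      2 * (((p.1 : ℝ) - outcome p.2) * endHat ε (unitInterval.symm p.1)) + 16 * ε)
      (D : Measure (unitInterval × Bool)) :=
    ((i1.const_mul 2).add (i2.const_mul 2)).add (integrable_const _)
  -- Replacing `w` by `w ∘ π` costs at most `2|f - y|`, and only at the ends, where one hat equals
  -- `1`. Each hat term plus `4ε` is nonnegative everywhere, so the other end does no harm; doubling
  -- both gives `16ε`.
  have hpt : ∀ p : unitInterval × Bool, ((p.1 : ℝ) - outcome p.2) * w p.1 ≤
      ((p.1 : ℝ) - outcome p.2) * w (π p.1) +
      (2 * (((p.1 : ℝ) - outcome p.2) * -endHat ε p.1) +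
      2 * (((p.1 : ℝ) - outcome p.2) * endHat ε (unitInterval.symm p.1)) + 16 * ε) := by
    rintro ⟨u, y⟩
    simp only
    have l1 := abs_sub_outcome_mul_endHat_le hε u y
    have l2 := abs_sub_outcome_mul_endHat_symm_le hε u y
    have a0 := abs_nonneg ((u : ℝ) - outcome y)
    have n1 := mul_nonneg a0 (endHat_nonneg ε u)
    have n2 := mul_nonneg a0 (endHat_nonneg ε (unitInterval.symm u))
    have hdiff : ((u : ℝ) - outcome y) * w u - (u - outcome y) * w (π u) ≤
        2 * |(u : ℝ) - outcome y| := by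
      rw [← mul_sub]
      refine (le_abs_self _).trans ?_
      rw [abs_mul, mul_comm]
      refine mul_le_mul_of_nonneg_right (abs_le.2 ⟨?_, ?_⟩) a0 <;>
        linarith [(hw u).1, (hw u).2, (hw (π u)).1, (hw (π u)).2]
    by_cases h1 : (u : ℝ) ≤ ε
    · rw [endHat_of_le hε h1] at l1 ⊢
      linarith
    by_cases h2 : 1 - ε ≤ (u : ℝ)
    · have h3 : ((unitInterval.symm u : unitInterval) : ℝ) ≤ ε := by
        rw [unitInterval.coe_symm_eq]
        linarith
      rw [endHat_of_le hε h3] at l2 ⊢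
      linarith
    · rw [hπid u ⟨(not_le.1 h1).le, (not_le.1 h2).le⟩]
      linarith
  calc _ ≤ ∫ p, (((p.1 : ℝ) - outcome p.2) * w (π p.1) +
      (2 * (((p.1 : ℝ) - outcome p.2) * -endHat ε p.1) +
      2 * (((p.1 : ℝ) - outcome p.2) * endHat ε (unitInterval.symm p.1)) + 16 * ε))
      ∂(D : Measure (unitInterval × Bool)) :=
        integral_mono (integrable_sub_outcome_mul D hwm hw) (i0.add i12) hpt
    _ = ∫ p, ((p.1 : ℝ) - outcome p.2) * w (π p.1) ∂(D : Measure (unitInterval × Bool)) +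
        (2 * ∫ p, ((p.1 : ℝ) - outcome p.2) * -endHat ε p.1 ∂(D : Measure (unitInterval × Bool)) +
        2 * ∫ p, ((p.1 : ℝ) - outcome p.2) * endHat ε (unitInterval.symm p.1)
          ∂(D : Measure (unitInterval × Bool)) + 16 * ε) := by
        have i3 : Integrable (fun p : unitInterval × Bool =>
          2 * (((p.1 : ℝ) - outcome p.2) * -endHat ε p.1) +
          2 * (((p.1 : ℝ) - outcome p.2) * endHat ε (unitInterval.symm p.1)))
          (D : Measure (unitInterval × Bool)) := (i1.const_mul 2).add (i2.const_mul 2)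
        rw [integral_add i0 i12, integral_add i3 (integrable_const _),
          integral_add (i1.const_mul 2) (i2.const_mul 2), integral_const_mul, integral_const_mul]
        simp
    _ ≤ K * wCE D + (2 * (1 / ε * wCE D) + 2 * (1 / ε * wCE D) + 16 * ε) := by gcongr
    _ = _ := by ring

/-- For a tested value `s > 0`, `ε = s / 32` makes `16ε = s / 2`, which is absorbed on the left.
Multiplying by `s ^ (q - 1)` cancels `s⁻ᶜ` and `s⁻¹`, since `s ≤ 1` and `q - 1 ≥ max c 1`. -/
lemma wCEWith_rpow_le {c : ℝ} (hc : 0 < c) {d : unitInterval → unitInterval → ℝ≥0∞}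
    (hI : InteriorBound c d) (D : PredDist) :
    wCEWith d D ^ (max (c + 1) 2) ≤ 2 * (32 ^ c + 128) * wCE D := by
  set q := max (c + 1) 2 with hq
  have hq2 : 2 ≤ q := le_max_right _ _
  have hqc : c + 1 ≤ q := le_max_left _ _
  have hη : 0 ≤ wCE D := wCEWith_nonneg _ D
  have hR : 0 ≤ 2 * ((32 : ℝ) ^ c + 128) * wCE D := by positivity
  rw [← Real.le_rpow_inv_iff_of_pos (wCEWith_nonneg d D) hR (by linarith)]
  refine csSup_le ⟨0, fun _ => 0, measurable_const, by simp, by simp, by simp⟩ ?_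
  rintro r ⟨w, hwm, hw, hwd, rfl⟩
  set s := ∫ p, ((p.1 : ℝ) - outcome p.2) * w p.1 ∂(D : Measure (unitInterval × Bool)) with hs
  rcases le_or_gt s 0 with hs0 | hs0
  · exact hs0.trans (Real.rpow_nonneg hR _)
  have hs1 : s ≤ 1 := (le_abs_self _).trans (abs_integral_mul_le_one D hw)
  rw [Real.le_rpow_inv_iff_of_pos hs0.le hR (by linarith)]
  have hε : 0 < s / 32 := by positivity
  have hmain := integral_mul_le_of_lipschitz_interior D hwm hw (K := (s / 32) ^ (-c)) hε
    (by linarith) (Real.one_le_rpow_of_pos_of_le_one_of_nonpos hε (by linarith) (by linarith))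
    fun u v hu hv => by
      have := (hwd u v).trans (hI _ hε u v hu hv)
      rw [ENNReal.ofReal_le_ofReal_iff (by positivity)] at this
      rwa [mul_comm]
  rw [← hs] at hmain
  have e1 : s ≤ 2 * (((s / 32) ^ (-c) + 4 / (s / 32)) * wCE D) := by linarith
  have e2 : s ^ q = s * s ^ (q - 1) := by
    rw [← Real.rpow_one_add' hs0.le (by linarith)]
    congr 1
    ring
  have e3 : (s / 32) ^ (-c) * s ^ (q - 1) ≤ 32 ^ c := by
    rw [Real.div_rpow hs0.le (by norm_num), Real.rpow_neg (by norm_num : (0 : ℝ) ≤ 32),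
      div_inv_eq_mul, mul_right_comm, ← Real.rpow_add hs0]
    exact mul_le_of_le_one_left (by positivity) (Real.rpow_le_one hs0.le hs1 (by linarith))
  have e4 : 4 / (s / 32) * s ^ (q - 1) ≤ 128 := by
    have : s ^ (q - 1) ≤ s := by
      simpa using Real.rpow_le_rpow_of_exponent_ge hs0 hs1 (by linarith : (1 : ℝ) ≤ q - 1)
    calc 4 / (s / 32) * s ^ (q - 1) ≤ 4 / (s / 32) * s := by gcongr
      _ = 128 := by field_simp; norm_num
  calc s ^ q = s * s ^ (q - 1) := e2
    _ ≤ 2 * (((s / 32) ^ (-c) + 4 / (s / 32)) * wCE D) * s ^ (q - 1) := by gcongr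
    _ = 2 * ((s / 32) ^ (-c) * s ^ (q - 1) + 4 / (s / 32) * s ^ (q - 1)) * wCE D := by ring
    _ ≤ _ := by gcongr

end Calibration

theorem mainTheorem4 (c : ℝ) (hc : 0 < c) :
    (∀ d : unitInterval → unitInterval → ENNReal, Calibration.IsExtMetric d →
      (∃ k : ℝ, 0 < k ∧ ∀ u v : unitInterval, ENNReal.ofReal (k * |(u : ℝ) - (v : ℝ)|) ≤ d u v) →
      Calibration.InteriorBound c d →
      Calibration.IsConsistentCalibrationMeasure (Calibration.dCEWith d)) ∧
    (∃ C : ℝ, 0 < C ∧ ∀ d : unitInterval → unitInterval → ENNReal, Calibration.IsExtMetric d →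
      Calibration.InteriorBound c d →
      ∀ D : Calibration.PredDist,
        Calibration.wCEWith d D ^ (max (c + 1) 2) ≤ C * Calibration.wCE D) :=
  ⟨fun _ hd hk hI => Calibration.isConsistentCalibrationMeasure_dCEWith hc hd hk hI,
    2 * (32 ^ c + 128), by positivity,
    fun _ _ hI D => Calibration.wCEWith_rpow_le hc hI D⟩
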